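/- **Restricted strong convexity for weight-normalized networks under square loss.** *Network.* Let $d,m,L\ge 1$ and put $m_0=d$, $m_1=\dots=m_L=m$. For parameters $\theta=(W^{(1)},\dots,W^{(L)},v)\in\mathbb{R}^p$, $p=dm+(L-1)m^2+m$, with $W^{(l)}\in\mathbb{R}^{m_l\times m_{l-1}}$ having rows $W^{(l)}_i$ and $v\in\mathbb{R}^m$, define for $x\in\mathbb{R}^d$ $$\alpha^{(0)}(x)=x,\qquad \alpha^{(l)}_i(x)=\phi\Big(\tfrac{1}{\sqrt{m_l}}\tfrac{\langle W^{(l)}_i,\alpha^{(l-1)}(x)\rangle}{\|W^{(l)}_i\|_2}\Big)\ (1\le i\le m_l,\ 1\le l\le L),\qquad f(\theta;x)=\langle v,\alpha^{(L)}(x)\rangle$$ (with the convention that the quotient is $0$ if $W_i^{(l)}=0$). For data $(x_i,y_i)\in\mathbb{R}^d\times\mathbb{R}$, $i=1,\dots,n$, let $\mathcal{L}(\theta)=\frac1n\sum_{i=1}^n(y_i-f(\theta;x_i))^2$, and let $\|\bar W\|=\min_{l,i}\|W^{(l)}_i\|_2$ be the smallest norm of a row of the weight matrices of $\theta$. *Assumptions.*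 The activation $\phi:\mathbb{R}\to\mathbb{R}$ is twice differentiable with $|\phi'|\le 1$ and $|\phi''|\le\beta_\phi$; $\|x_i\|_2=1$ for all $i$; $\frac1n\sum_i y_i^2\le Y^2$; $v_0\in\mathbb{R}^m$ with $\|v_0\|_2=1$; $\kappa\in(0,1]$ and $\rho_1,\rho_2>0$. For $\theta\in\mathbb{R}^p$ let $$Q^\theta_\kappa=\{\hat\theta\in\mathbb{R}^p : |\cos(\hat\theta-\theta,\nabla\mathcal{L}(\theta))|\ge\kappa\},$$ where $\cos(a,b)$ is the cosine of the angle between $a$ and $b$, taken as $0$ if $a=0$ or $b=0$; balls $B_\rho(\cdot)$ are closed Euclidean balls. *Claim.* For all $\beta_\phi$ and $Y$ there is a constant $C>0$, depending only on $\beta_\phi$ and $Y$, such that the following holds for all $d,m,L,n,\phi,(x_i,y_i),v_0,\kappa,\rho_1,\rho_2$ as above. Let $\theta\in\mathbb{R}^p$ have only nonzero rows $W^{(l)}_i$ and output vector $v\in B_{\rho_1}(v_0)$. Then $\mathcal{L}$ is differentiable at $\theta$, and for every $\theta'\in Q^\theta_\kappa\cap B_{\rho_2}(\theta)$ with output vector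 $v'\in B_{\rho_1}(v_0)$, $$\mathcal{L}(\theta')\ \ge\ \mathcal{L}(\theta)+\langle\theta'-\theta,\nabla\mathcal{L}(\theta)\rangle+\frac{\alpha_\theta}{2}\|\theta'-\theta\|_2^2,$$ where $$\alpha_\theta=\frac{\kappa^2}{2}\frac{\|\nabla\mathcal{L}(\theta)\|_2^2}{\mathcal{L}(\theta)}-C\Big(1+\frac{\sqrt L}{\|\bar W\|}\Big)\frac{(1+\rho_2)(1+\rho_1)^3L^3\big(\frac1{\sqrt m}+L^2\max\{|\phi(0)|,|\phi(0)|^2\}\big)\big(1+L|\phi(0)|\sqrt m\big)}{\min\{\|\bar W\|,\|\bar W\|^2\}}.$$ If moreover $\phi(0)=0$, then the same inequality holds with $$\alpha_\theta=\frac{\kappa^2}{2}\frac{\|\nabla\mathcal{L}(\theta)\|_2^2}{\mathcal{L}(\theta)}-C\Big(1+\frac{\sqrt L}{\sqrt m\,\|\bar W\|}\Big)\frac{(1+\rho_2)(1+\rho_1)^3L^3}{\sqrt m\,\min\{\|\bar W\|,\|\bar W\|^2\}}.$$ (If $Q^\theta_\kappa$ is nonempty, then $\nabla\mathcal{L}(\theta)\neq0$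 and hence $\mathcal{L}(\theta)>0$.) -/

import Mathlib

namespace WeightNorm

/-- Index type of the parameters of a network of depth `L` whose layer `l` has width `w l`
(`w 0` is the input dimension): the entries `W^{(l+1)}_{ij}` of the weight matrices
`W^{(l+1)} ∈ ℝ^{w (l+1) × w l}`, `l = 0, …, L - 1`, and the entries of the output vector. -/
abbrev ParamIndex (w : ℕ → ℕ) (L : ℕ) : Type :=
  (Σ l : Fin L, Fin (w (l + 1)) × Fin (w l)) ⊕ Fin (w L)

/-- The parameter space `ℝ^p`, `p = ∑_{l=1}^{L} m_l m_{l-1} + m_L`, with its Euclidean norm. -/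
abbrev Param (w : ℕ → ℕ) (L : ℕ) : Type := EuclideanSpace ℝ (ParamIndex w L)

/-- The weight vector `W^{(l+1)}_i`: the `i`-th row of the weight matrix of layer `l + 1`. -/
noncomputable def row {w : ℕ → ℕ} {L : ℕ} (θ : Param w L) (l : Fin L) (i : Fin (w (l + 1))) :
    EuclideanSpace ℝ (Fin (w l)) :=
  WithLp.toLp 2 fun j => θ (Sum.inl ⟨l, (i, j)⟩)

/-- The vector `v` of the linear output layer. -/
noncomputable def outVec {w : ℕ → ℕ} {L : ℕ} (θ : Param w L) : EuclideanSpace ℝ (Fin (w L)) :=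
  WithLp.toLp 2 fun i => θ (Sum.inr i)

/-- The activations `α^{(l)}(x)`, `0 ≤ l ≤ L`, of the network with weight normalization:
`α^{(0)}(x) = x` and
`α^{(l+1)}_i(x) = φ ((1 / √m_{l+1}) ⟨W^{(l+1)}_i, α^{(l)}(x)⟩ / ‖W^{(l+1)}_i‖)`. -/
noncomputable def act (φ : ℝ → ℝ) {w : ℕ → ℕ} {L : ℕ} (θ : Param w L)
    (x : EuclideanSpace ℝ (Fin (w 0))) : (l : ℕ) → l ≤ L → EuclideanSpace ℝ (Fin (w l))
  | 0, _ => x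
  | l + 1, h => WithLp.toLp 2 fun i =>
      φ (1 / √(w (l + 1) : ℝ) *
        (inner ℝ (row θ ⟨l, h⟩ i) (act φ θ x l (Nat.le_of_succ_le h)) / ‖row θ ⟨l, h⟩ i‖))

/-- The predictor `f(θ; x) = vᵀ α^{(L)}(x)`. -/
noncomputable def predictor (φ : ℝ → ℝ) {w : ℕ → ℕ} {L : ℕ} (θ : Param w L)
    (x : EuclideanSpace ℝ (Fin (w 0))) : ℝ :=
  inner ℝ (outVec θ) (act φ θ x L le_rfl)

/-- The empirical square loss `𝓛(θ) = (1/n) ∑ᵢ (yᵢ - f(θ; xᵢ))²`. -/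
noncomputable def empLoss (φ : ℝ → ℝ) {w : ℕ → ℕ} {L n : ℕ}
    (x : Fin n → EuclideanSpace ℝ (Fin (w 0))) (y : Fin n → ℝ) (θ : Param w L) : ℝ :=
  (1 / (n : ℝ)) * ∑ i, (y i - predictor φ θ (x i)) ^ 2

/-- The minimum weight vector norm `min_{l, i} ‖W^{(l)}_i‖` (over a finite index set). -/
noncomputable def minRowNorm {w : ℕ → ℕ} {L : ℕ} (θ : Param w L) : ℝ :=
  ⨅ p : Σ l : Fin L, Fin (w (l + 1)), ‖row θ p.1 p.2‖

/-- The set of all `θ'` for which the cosine of the angle between `θ' - θ` and the gradient of `F`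
at `θ` has absolute value at least `κ`. In Mathlib the cosine is `0` if one of the two vectors
vanishes, so that for `κ > 0` such `θ'` are not in the set. -/
def qSet {w : ℕ → ℕ} {L : ℕ} (F : Param w L → ℝ) (κ : ℝ) (θ : Param w L) : Set (Param w L) :=
  {θ' | κ ≤ |Real.cos (InnerProductGeometry.angle (θ' - θ) (gradient F θ))|}

/-- The correction term for a general activation function; `a = |φ(0)|` and `W` is the minimum
weight vector norm. -/
noncomputable def correction (m L : ℕ) (ρ₁ ρ₂ a W : ℝ) : ℝ :=
  (1 + √(L : ℝ) / W) *
    ((1 + ρ₂) * (1 + ρ₁) ^ 3 * (L : ℝ) ^ 3 *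
        (1 / √(m : ℝ) + (L : ℝ) ^ 2 * max a (a ^ 2)) * (1 + (L : ℝ) * a * √(m : ℝ)) /
      min W (W ^ 2))

/-- The correction term for an activation function with `φ(0) = 0`. -/
noncomputable def correctionZero (m L : ℕ) (ρ₁ ρ₂ W : ℝ) : ℝ :=
  (1 + √(L : ℝ) / (√(m : ℝ) * W)) *
    ((1 + ρ₂) * (1 + ρ₁) ^ 3 * (L : ℝ) ^ 3 / (√(m : ℝ) * min W (W ^ 2)))

/-- The parameter `α_θ = (κ²/2) ‖∇F(θ)‖² / F(θ) - E` of restricted strong convexity, with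
correction `E`. -/
noncomputable def rscParam {w : ℕ → ℕ} {L : ℕ} (F : Param w L → ℝ) (κ E : ℝ)
    (θ : Param w L) : ℝ :=
  κ ^ 2 / 2 * (‖gradient F θ‖ ^ 2 / F θ) - E

end WeightNorm

/-! The segment from `θ` to `θ'` may pass through zero rows, where normalization is discontinuous,
so a Hessian along the segment is not available. Instead, `norm_unitVec_sub_sub_le` shows that the
first order expansion of `w / ‖w‖` at a nonzero `w` has a quadratic remainder on the whole space,
with constants depending only on `‖w‖`. Each layer is 1-Lipschitz in its input, since unit rows
cancel the factor `1 / √m`, so remainders add over the layers instead of multiplying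
(`exists_act_expansion`, `exists_predictor_expansion`).

For the square loss, let `r` be the residual, `g` the linear part and `e` the remainder of the
predictor. Then `(r - g - e)² ≥ r² - 2rg + g² + 2ge - 2re`. The mean of `-2rg` is the gradient term
`I`. Cauchy–Schwarz gives `I² ≤ 4 F(θ) · mean(g²)`, and the cosine condition bounds `|I|` below by
`κ ‖θ' - θ‖ ‖∇F(θ)‖`. Hence `mean(g²)` supplies the term `κ²/2 · ‖∇F‖² / F`, while `2ge - 2re` is
the correction (`squareLoss_restricted_strong_convexity`). The rest is an estimate of constants. -/

namespace WeightNorm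

/-! ### Normalization of a single vector -/

section Normalization

variable {V : Type*} [NormedAddCommGroup V] [InnerProductSpace ℝ V]

/-- The normalization `w / ‖w‖`, with value `0` at `0`. -/
noncomputable def unitVec (w : V) : V := ‖w‖⁻¹ • w

/-- The derivative of the normalization at `w ≠ 0`. -/
noncomputable def unitVecDeriv (w : V) : V →ₗ[ℝ] V :=
  ‖w‖⁻¹ • (LinearMap.id - (innerₛₗ ℝ (unitVec w)).smulRight (unitVec w))

theorem unitVecDeriv_apply (w h : V) :
    unitVecDeriv w h = ‖w‖⁻¹ • (h - inner ℝ (unitVec w) h • unitVec w) := by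
  simp [unitVecDeriv]

theorem norm_unitVec_le (w : V) : ‖unitVec w‖ ≤ 1 := by
  rw [unitVec, norm_smul, norm_inv, norm_norm]
  exact inv_mul_le_one

theorem norm_smul_unitVec (w : V) : ‖w‖ • unitVec w = w := by
  rcases eq_or_ne w 0 with rfl | h
  · simp [unitVec]
  · rw [unitVec, smul_smul, mul_inv_cancel₀ (norm_ne_zero_iff.2 h), one_smul]

/-- Multiplying by `‖w‖` leaves `(u - w) + (‖w‖ - ‖u‖) û`, with no division by `‖u‖`; hence `u = 0`
is allowed. -/
theorem norm_unitVec_sub_le {w : V} (hw : w ≠ 0) (u : V) :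
    ‖unitVec u - unitVec w‖ ≤ 2 * ‖u - w‖ / ‖w‖ := by
  have hw' : 0 < ‖w‖ := norm_pos_iff.2 hw
  have key : ‖w‖ • (unitVec u - unitVec w) = (u - w) + (‖w‖ - ‖u‖) • unitVec u := by
    rw [smul_sub, norm_smul_unitVec, sub_smul, norm_smul_unitVec]; abel
  rw [le_div_iff₀ hw', mul_comm, ← norm_norm w, ← norm_smul, key]
  calc ‖(u - w) + (‖w‖ - ‖u‖) • unitVec u‖ ≤ ‖u - w‖ + |‖w‖ - ‖u‖| * ‖unitVec u‖ := by
        refine (norm_add_le _ _).trans ?_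
        rw [norm_smul, Real.norm_eq_abs]
    _ ≤ ‖u - w‖ + ‖u - w‖ * 1 := by
        gcongr
        · rw [norm_sub_rev u w]; exact abs_norm_sub_norm_le _ _
        · exact norm_unitVec_le u
    _ = 2 * ‖u - w‖ := by ring

theorem norm_unitVecDeriv_le (w h : V) : ‖unitVecDeriv w h‖ ≤ 2 * ‖h‖ / ‖w‖ := by
  rw [unitVecDeriv_apply, norm_smul, norm_inv, norm_norm, inv_mul_eq_div]
  gcongr
  calc ‖h - inner ℝ (unitVec w) h • unitVec w‖ ≤ ‖h‖ + ‖h‖ := by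
        refine (norm_sub_le _ _).trans ?_
        gcongr
        rw [norm_smul]
        have h1 : ‖(inner ℝ (unitVec w) h : ℝ)‖ ≤ ‖h‖ :=
          (norm_inner_le_norm _ _).trans
            (mul_le_of_le_one_left (norm_nonneg _) (norm_unitVec_le w))
        exact (mul_le_of_le_one_right (norm_nonneg _) (norm_unitVec_le w)).trans h1
    _ = 2 * ‖h‖ := by ring

/-- The second order remainder of the normalization at `w ≠ 0` is quadratic on the whole space. -/
theorem norm_unitVec_sub_sub_le {w : V} (hw : w ≠ 0) (u : V) :
    ‖unitVec u - unitVec w - unitVecDeriv w (u - w)‖ ≤ 3 * ‖u - w‖ ^ 2 / ‖w‖ ^ 2 := by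
  have hw' : 0 < ‖w‖ := norm_pos_iff.2 hw
  set c : ℝ := inner ℝ (unitVec w) (u - w) with hc
  have hcw : c * ‖w‖ = inner ℝ w u - ‖w‖ ^ 2 := by
    rw [hc, mul_comm, ← real_inner_smul_left, norm_smul_unitVec, inner_sub_right,
      real_inner_self_eq_norm_sq]
  -- Here `c` is the derivative of the norm at `w` along `u - w`. The first summand carries the
  -- second order remainder of the norm; the second is a product of two first order terms.
  have key : ‖w‖ • (unitVec u - unitVec w - unitVecDeriv w (u - w)) =
      -(‖u‖ - ‖w‖ - c) • unitVec u + c • (unitVec w - unitVec u) := by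
    rw [unitVecDeriv_apply, smul_sub, smul_sub, smul_smul ‖w‖, mul_inv_cancel₀ hw'.ne', one_smul,
      norm_smul_unitVec, ← hc]
    have h2 : (‖u‖ - ‖w‖ - c) • unitVec u = u - ‖w‖ • unitVec u - c • unitVec u := by
      rw [sub_smul, sub_smul, norm_smul_unitVec]
    rw [neg_smul, h2, smul_sub]; abel
  have hexp : ‖u - w‖ ^ 2 = ‖u‖ ^ 2 - 2 * inner ℝ w u + ‖w‖ ^ 2 := by
    rw [norm_sub_sq_real, real_inner_comm]
  -- Times `‖w‖`, the remainder is `‖w‖‖u‖ - ⟪w, u⟫ = (‖u - w‖² - (‖u‖ - ‖w‖)²) / 2`, nonnegative by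
  -- Cauchy–Schwarz.
  have h1 : |‖u‖ - ‖w‖ - c| ≤ ‖u - w‖ ^ 2 / ‖w‖ := by
    have hcs := real_inner_le_norm w u
    have h0 : (‖u‖ - ‖w‖ - c) * ‖w‖ = ‖w‖ * ‖u‖ - inner ℝ w u := by
      linear_combination -hcw
    rw [le_div_iff₀ hw', ← abs_of_pos hw', ← abs_mul, abs_of_pos hw', h0,
      abs_of_nonneg (by linarith)]
    nlinarith [sq_nonneg (‖u‖ - ‖w‖), sq_nonneg ‖u - w‖]
  have h2 : |c| ≤ ‖u - w‖ :=
    (abs_real_inner_le_norm _ _).trans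
      (mul_le_of_le_one_left (norm_nonneg _) (norm_unitVec_le w))
  have h3 : ‖unitVec w - unitVec u‖ ≤ 2 * ‖u - w‖ / ‖w‖ := by
    rw [norm_sub_rev]; exact norm_unitVec_sub_le hw u
  have h4 : ‖w‖ * ‖unitVec u - unitVec w - unitVecDeriv w (u - w)‖ ≤
      ‖u - w‖ ^ 2 / ‖w‖ * 1 + ‖u - w‖ * (2 * ‖u - w‖ / ‖w‖) := by
    conv_lhs => rw [← norm_norm w, ← norm_smul, key]
    refine (norm_add_le _ _).trans ?_
    rw [norm_smul, norm_smul, norm_neg, Real.norm_eq_abs, Real.norm_eq_abs]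
    gcongr
    exact norm_unitVec_le u
  rw [mul_comm, ← le_div_iff₀ hw'] at h4
  refine h4.trans (le_of_eq ?_)
  field_simp
  ring

end Normalization

/-! ### Matrices given by their rows -/

section Rows

/-- The Frobenius norm of the matrix with rows `a i`. -/
noncomputable def frob {V ι : Type*} [NormedAddCommGroup V] [Fintype ι] (a : ι → V) : ℝ :=
  ‖(WithLp.toLp 2 fun i => ‖a i‖ : EuclideanSpace ℝ ι)‖

theorem frob_nonneg {V ι : Type*} [NormedAddCommGroup V] [Fintype ι] (a : ι → V) :
    0 ≤ frob a := norm_nonneg _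

variable {V ι : Type*} [NormedAddCommGroup V] [InnerProductSpace ℝ V] [Fintype ι]

/-- The product of the matrix with rows `a i` and the vector `z`. -/
noncomputable def rowsMul (a : ι → V) (z : V) : EuclideanSpace ℝ ι :=
  WithLp.toLp 2 fun i => inner ℝ (a i) z

theorem norm_toLp_le_mul {ι : Type*} [Fintype ι] {f g : ι → ℝ} {c : ℝ} (hc : 0 ≤ c)
    (h : ∀ i, |f i| ≤ c * |g i|) :
    ‖(WithLp.toLp 2 f : EuclideanSpace ℝ ι)‖ ≤ c * ‖(WithLp.toLp 2 g : EuclideanSpace ℝ ι)‖ := by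
  rw [EuclideanSpace.norm_eq, EuclideanSpace.norm_eq, ← Real.sqrt_sq hc,
    ← Real.sqrt_mul (sq_nonneg c), Finset.mul_sum]
  refine Real.sqrt_le_sqrt (Finset.sum_le_sum fun i _ => ?_)
  rw [Real.norm_eq_abs, Real.norm_eq_abs, ← mul_pow]
  exact pow_le_pow_left₀ (abs_nonneg _) (h i) 2

theorem norm_toLp_le {ι : Type*} [Fintype ι] {f g : ι → ℝ} (h : ∀ i, |f i| ≤ |g i|) :
    ‖(WithLp.toLp 2 f : EuclideanSpace ℝ ι)‖ ≤ ‖(WithLp.toLp 2 g : EuclideanSpace ℝ ι)‖ := by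
  simpa using norm_toLp_le_mul zero_le_one (f := f) (g := g) (by simpa using h)

theorem norm_rowsMul_le (a : ι → V) (z : V) :
    ‖rowsMul a z‖ ≤ frob a * ‖z‖ := by
  rw [mul_comm]
  refine norm_toLp_le_mul (norm_nonneg _) fun i => ?_
  rw [abs_norm, mul_comm]
  exact abs_real_inner_le_norm _ _

/-- The norm of the squares of the coordinates is at most the square of the norm. -/
theorem norm_toLp_sq_le {ι : Type*} [Fintype ι] (f : ι → ℝ) :
    ‖(WithLp.toLp 2 fun i => f i ^ 2 : EuclideanSpace ℝ ι)‖ ≤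
      ‖(WithLp.toLp 2 f : EuclideanSpace ℝ ι)‖ ^ 2 := by
  rw [sq ‖_‖]
  refine norm_toLp_le_mul (norm_nonneg _) fun i => ?_
  rw [sq, abs_mul]
  gcongr
  simpa using PiLp.norm_apply_le (WithLp.toLp 2 f : EuclideanSpace ℝ ι) i

/-- Rows of norm at most 1 give Frobenius norm at most `√m`, which the scaling in `preact` cancels.
-/
theorem norm_rowsMul_unitVec_le (w : ι → V) (z : V) :
    ‖rowsMul (fun i => unitVec (w i)) z‖ ≤ √(Fintype.card ι : ℝ) * ‖z‖ := by
  refine (norm_rowsMul_le _ _).trans ?_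
  gcongr
  rw [frob, EuclideanSpace.norm_eq]
  refine Real.sqrt_le_sqrt ?_
  calc ∑ i, ‖‖unitVec (w i)‖‖ ^ 2 ≤ ∑ _i : ι, (1 : ℝ) := by
        refine Finset.sum_le_sum fun i _ => ?_
        rw [norm_norm]
        exact pow_le_one₀ (norm_nonneg _) (norm_unitVec_le _)
    _ = _ := by simp

variable {w : ι → V} {W : ℝ}

theorem norm_rowsMul_unitVec_sub_le (hW : 0 < W) (hw : ∀ i, W ≤ ‖w i‖) (u : ι → V) (z : V) :
    ‖rowsMul (fun i => unitVec (u i) - unitVec (w i)) z‖ ≤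
      2 / W * frob (fun i => u i - w i) * ‖z‖ := by
  refine (norm_rowsMul_le _ _).trans ?_
  gcongr
  refine norm_toLp_le_mul (by positivity) fun i => ?_
  rw [abs_norm, abs_norm]
  refine (norm_unitVec_sub_le (norm_pos_iff.1 (hW.trans_le (hw i))) (u i)).trans ?_
  rw [div_mul_eq_mul_div]
  have := hw i
  gcongr

theorem norm_rowsMul_unitVecDeriv_le (hW : 0 < W) (hw : ∀ i, W ≤ ‖w i‖) (h : ι → V) (z : V) :
    ‖rowsMul (fun i => unitVecDeriv (w i) (h i)) z‖ ≤ 2 / W * frob h * ‖z‖ := by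
  refine (norm_rowsMul_le _ _).trans ?_
  gcongr
  refine norm_toLp_le_mul (by positivity) fun i => ?_
  rw [abs_norm, abs_norm]
  refine (norm_unitVecDeriv_le (w i) (h i)).trans ?_
  rw [div_mul_eq_mul_div]
  have := hw i
  gcongr

theorem norm_rowsMul_unitVec_sub_sub_le (hW : 0 < W) (hw : ∀ i, W ≤ ‖w i‖) (u : ι → V) (z : V) :
    ‖rowsMul (fun i => unitVec (u i) - unitVec (w i) - unitVecDeriv (w i) (u i - w i)) z‖ ≤
      3 / W ^ 2 * frob (fun i => u i - w i) ^ 2 * ‖z‖ := by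
  refine (norm_rowsMul_le _ _).trans ?_
  gcongr
  refine le_trans ?_ (mul_le_mul_of_nonneg_left (norm_toLp_sq_le _) (by positivity))
  refine norm_toLp_le_mul (by positivity) fun i => ?_
  rw [abs_norm, abs_pow, abs_norm]
  refine (norm_unitVec_sub_sub_le (norm_pos_iff.1 (hW.trans_le (hw i))) (u i)).trans ?_
  rw [div_mul_eq_mul_div]
  have := hw i
  gcongr

end Rows

/-! ### The activation function, on scalars and coordinatewise -/

section Activation

variable {φ : ℝ → ℝ} {β : ℝ}

theorem abs_sub_le_of_abs_deriv_le {c : ℝ} (hφ : Differentiable ℝ φ) (h1 : ∀ t, |deriv φ t| ≤ c)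
    (s t : ℝ) : |φ t - φ s| ≤ c * |t - s| := by
  simpa using Convex.norm_image_sub_le_of_norm_deriv_le (s := Set.univ) (f := φ)
    (fun x _ => hφ x) (fun x _ => by simpa using h1 x) convex_univ (Set.mem_univ s) (Set.mem_univ t)

/-- The mean value inequality for `r ↦ φ r - φ'(s) r` on the segment needs no continuity of `φ''`;
the price is `β` in place of `β / 2`. -/
theorem abs_sub_sub_deriv_mul_le (hφ : Differentiable ℝ φ) (hφ' : Differentiable ℝ (deriv φ))
    (h2 : ∀ t, |deriv (deriv φ) t| ≤ β) (s t : ℝ) :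
    |φ t - φ s - deriv φ s * (t - s)| ≤ β * (t - s) ^ 2 := by
  have hβ : 0 ≤ β := (abs_nonneg _).trans (h2 0)
  have := Convex.norm_image_sub_le_of_norm_hasDerivWithin_le (s := Set.uIcc s t)
    (f := fun r => φ r - deriv φ s * r) (f' := fun r => deriv φ r - deriv φ s * 1)
    (C := β * |t - s|)
    (fun x _ => ((hφ x).hasDerivAt.sub ((hasDerivAt_id x).const_mul _)).hasDerivWithinAt)
    (fun x hx => by
      rw [mul_one, Real.norm_eq_abs]
      refine (abs_sub_le_of_abs_deriv_le hφ' h2 s x).trans ?_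
      gcongr 1
      exact Set.abs_sub_left_of_mem_uIcc hx)
    (convex_uIcc s t) Set.left_mem_uIcc Set.right_mem_uIcc
  rw [Real.norm_eq_abs, Real.norm_eq_abs] at this
  calc |φ t - φ s - deriv φ s * (t - s)|
      = |φ t - deriv φ s * t - (φ s - deriv φ s * s)| := by congr 1; ring
    _ ≤ β * |t - s| * |t - s| := this
    _ = β * (t - s) ^ 2 := by rw [mul_assoc, ← sq, sq_abs]

variable {ι : Type*} [Fintype ι]

/-- The activation function applied to each coordinate. -/
noncomputable def mapVec (φ : ℝ → ℝ) (s : EuclideanSpace ℝ ι) : EuclideanSpace ℝ ι :=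
  WithLp.toLp 2 fun i => φ (s i)

/-- The derivative of `mapVec φ` at `s`. -/
noncomputable def mapVecDeriv (φ : ℝ → ℝ) (s : EuclideanSpace ℝ ι) :
    EuclideanSpace ℝ ι →ₗ[ℝ] EuclideanSpace ℝ ι where
  toFun h := WithLp.toLp 2 fun i => deriv φ (s i) * h i
  map_add' h k := by ext i; simp [mul_add]
  map_smul' c h := by ext i; simp [mul_left_comm]

theorem norm_mapVec_sub_le (hφ : Differentiable ℝ φ) (h1 : ∀ t, |deriv φ t| ≤ 1)
    (s t : EuclideanSpace ℝ ι) : ‖mapVec φ t - mapVec φ s‖ ≤ ‖t - s‖ := by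
  refine norm_toLp_le (f := fun i => φ (t i) - φ (s i)) (g := fun i => t i - s i) fun i => ?_
  simpa using abs_sub_le_of_abs_deriv_le hφ h1 (s i) (t i)

theorem norm_mapVec_le (hφ : Differentiable ℝ φ) (h1 : ∀ t, |deriv φ t| ≤ 1)
    (s : EuclideanSpace ℝ ι) : ‖mapVec φ s‖ ≤ ‖s‖ + |φ 0| * √(Fintype.card ι : ℝ) := by
  have h0 : ‖mapVec φ (0 : EuclideanSpace ℝ ι)‖ = |φ 0| * √(Fintype.card ι : ℝ) := by
    rw [EuclideanSpace.norm_eq]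
    simp only [mapVec, PiLp.zero_apply, Finset.sum_const, Finset.card_univ, nsmul_eq_mul,
      Real.norm_eq_abs, sq_abs]
    rw [mul_comm, Real.sqrt_mul (sq_nonneg _), Real.sqrt_sq_eq_abs]
  have h := norm_mapVec_sub_le hφ h1 0 s
  rw [sub_zero] at h
  calc ‖mapVec φ s‖ = ‖(mapVec φ s - mapVec φ 0) + mapVec φ 0‖ := by rw [sub_add_cancel]
    _ ≤ _ := (norm_add_le _ _).trans (by rw [h0]; gcongr)

theorem norm_mapVecDeriv_le (h1 : ∀ t, |deriv φ t| ≤ 1) (s h : EuclideanSpace ℝ ι) :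
    ‖mapVecDeriv φ s h‖ ≤ ‖h‖ := by
  refine norm_toLp_le (f := fun i => deriv φ (s i) * h i) (g := fun i => h i) fun i => ?_
  rw [abs_mul]
  exact mul_le_of_le_one_left (abs_nonneg _) (h1 _)

theorem norm_mapVec_sub_sub_le (hφ : Differentiable ℝ φ) (hφ' : Differentiable ℝ (deriv φ))
    (h2 : ∀ t, |deriv (deriv φ) t| ≤ β) (s t : EuclideanSpace ℝ ι) :
    ‖mapVec φ t - mapVec φ s - mapVecDeriv φ s (t - s)‖ ≤ β * ‖t - s‖ ^ 2 := by
  have hβ : 0 ≤ β := (abs_nonneg _).trans (h2 0)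
  refine le_trans ?_ (mul_le_mul_of_nonneg_left (norm_toLp_sq_le fun i => (t - s) i) hβ)
  refine norm_toLp_le_mul
    (f := fun i => φ (t i) - φ (s i) - deriv φ (s i) * (t - s) i) hβ fun i => ?_
  rw [abs_of_nonneg (sq_nonneg ((t - s) i))]
  exact abs_sub_sub_deriv_mul_le hφ hφ' h2 (s i) (t i)

end Activation

/-! ### One layer as a function of weights and input -/

section Layer

variable {V ι : Type*} [NormedAddCommGroup V] [InnerProductSpace ℝ V] [Fintype ι]

/-- The product of the row-normalized weight matrix with the input, scaled by `1 / √m`. -/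
noncomputable def preact (w : ι → V) (z : V) : EuclideanSpace ℝ ι :=
  (√(Fintype.card ι : ℝ))⁻¹ • rowsMul (fun i => unitVec (w i)) z

/-- The derivative of `preact` at `(w, z)`. -/
noncomputable def preactDeriv (w : ι → V) (z : V) :
    (ι → V) × V →ₗ[ℝ] EuclideanSpace ℝ ι where
  toFun p := (√(Fintype.card ι : ℝ))⁻¹ • (rowsMul (fun i => unitVec (w i)) p.2 +
    rowsMul (fun i => unitVecDeriv (w i) (p.1 i)) z)
  map_add' p q := by
    ext i; simp [rowsMul, inner_add_left, inner_add_right]; ring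
  map_smul' c p := by
    ext i; simp [rowsMul, inner_smul_left, inner_smul_right]; ring

/-- One layer of the network. -/
noncomputable def layer (φ : ℝ → ℝ) (w : ι → V) (z : V) : EuclideanSpace ℝ ι :=
  mapVec φ (preact w z)

/-- The derivative of `layer φ` at `(w, z)`. -/
noncomputable def layerDeriv (φ : ℝ → ℝ) (w : ι → V) (z : V) :
    (ι → V) × V →ₗ[ℝ] EuclideanSpace ℝ ι :=
  mapVecDeriv φ (preact w z) ∘ₗ preactDeriv w z

theorem norm_preact_le (w : ι → V) (z : V) : ‖preact w z‖ ≤ ‖z‖ := by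
  rw [preact, norm_smul, norm_inv, Real.norm_of_nonneg (Real.sqrt_nonneg _)]
  calc _ ≤ (√(Fintype.card ι : ℝ))⁻¹ * (√(Fintype.card ι : ℝ) * ‖z‖) := by
        gcongr; exact norm_rowsMul_unitVec_le w z
    _ = (√(Fintype.card ι : ℝ))⁻¹ * √(Fintype.card ι : ℝ) * ‖z‖ := by ring
    _ ≤ ‖z‖ := mul_le_of_le_one_left (norm_nonneg _) inv_mul_le_one

variable {w : ι → V} {W : ℝ}

theorem preact_sub_right (u : ι → V) (z z' : V) : preact u (z' - z) = preact u z' - preact u z := by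
  ext i; simp [preact, rowsMul, inner_sub_right]; ring

theorem norm_preact_sub_left_le (hW : 0 < W) (hw : ∀ i, W ≤ ‖w i‖) (u : ι → V) (z : V) :
    ‖preact u z - preact w z‖ ≤
      (√(Fintype.card ι : ℝ))⁻¹ * (2 / W * frob (fun i => u i - w i) * ‖z‖) := by
  have : preact u z - preact w z = (√(Fintype.card ι : ℝ))⁻¹ •
      rowsMul (fun i => unitVec (u i) - unitVec (w i)) z := by
    ext i; simp [preact, rowsMul, inner_sub_left]; ring
  rw [this, norm_smul, norm_inv, Real.norm_of_nonneg (Real.sqrt_nonneg _)]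
  gcongr
  exact norm_rowsMul_unitVec_sub_le hW hw u z

theorem norm_preact_sub_le (hW : 0 < W) (hw : ∀ i, W ≤ ‖w i‖) (u : ι → V) (z z' : V) :
    ‖preact u z' - preact w z‖ ≤ ‖z' - z‖ +
      (√(Fintype.card ι : ℝ))⁻¹ * (2 / W * frob (fun i => u i - w i) * ‖z‖) := by
  rw [← sub_add_sub_cancel _ (preact u z), ← preact_sub_right]
  exact (norm_add_le _ _).trans
    (add_le_add (norm_preact_le _ _) (norm_preact_sub_left_le hW hw u z))

theorem norm_preactDeriv_le (hW : 0 < W) (hw : ∀ i, W ≤ ‖w i‖) (h : ι → V) (z dz : V) :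
    ‖preactDeriv w z (h, dz)‖ ≤ ‖dz‖ +
      (√(Fintype.card ι : ℝ))⁻¹ * (2 / W * frob h * ‖z‖) := by
  have : preactDeriv w z (h, dz) = preact w dz + (√(Fintype.card ι : ℝ))⁻¹ •
      rowsMul (fun i => unitVecDeriv (w i) (h i)) z := by
    simp [preactDeriv, preact]
  rw [this]
  refine (norm_add_le _ _).trans (add_le_add (norm_preact_le _ _) ?_)
  rw [norm_smul, norm_inv, Real.norm_of_nonneg (Real.sqrt_nonneg _)]
  gcongr
  exact norm_rowsMul_unitVecDeriv_le hW hw h z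

/-- `preact` is linear in the input, so the error splits into the incoming error `z' - z - dz`, the
normalization remainder at `z`, and the product of the weight and input changes. -/
theorem norm_preact_sub_sub_le (hW : 0 < W) (hw : ∀ i, W ≤ ‖w i‖) (u : ι → V) (z z' dz : V) :
    ‖preact u z' - preact w z - preactDeriv w z (fun i => u i - w i, dz)‖ ≤ ‖z' - z - dz‖ +
      (√(Fintype.card ι : ℝ))⁻¹ * (3 / W ^ 2 * frob (fun i => u i - w i) ^ 2 * ‖z‖) +
      (√(Fintype.card ι : ℝ))⁻¹ * (2 / W * frob (fun i => u i - w i) * ‖z' - z‖) := by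
  have : preact u z' - preact w z - preactDeriv w z (fun i => u i - w i, dz) =
      preact w (z' - z - dz) + (√(Fintype.card ι : ℝ))⁻¹ •
        rowsMul (fun i => unitVec (u i) - unitVec (w i) - unitVecDeriv (w i) (u i - w i)) z +
      (preact u (z' - z) - preact w (z' - z)) := by
    ext i
    simp [preact, preactDeriv, rowsMul, inner_sub_left, inner_sub_right]
    ring
  rw [this]
  refine (norm_add₃_le).trans
    (add_le_add_three (norm_preact_le _ _) ?_ (norm_preact_sub_left_le hW hw u _))
  rw [norm_smul, norm_inv, Real.norm_of_nonneg (Real.sqrt_nonneg _)]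
  gcongr
  exact norm_rowsMul_unitVec_sub_sub_le hW hw u z

variable {φ : ℝ → ℝ} {β : ℝ}

theorem norm_layer_le (hφ : Differentiable ℝ φ) (h1 : ∀ t, |deriv φ t| ≤ 1) (w : ι → V) (z : V) :
    ‖layer φ w z‖ ≤ ‖z‖ + |φ 0| * √(Fintype.card ι : ℝ) :=
  (norm_mapVec_le hφ h1 _).trans (by gcongr; exact norm_preact_le w z)

theorem norm_layer_sub_le (hφ : Differentiable ℝ φ) (h1 : ∀ t, |deriv φ t| ≤ 1)
    (hW : 0 < W) (hw : ∀ i, W ≤ ‖w i‖) (u : ι → V) (z z' : V) :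
    ‖layer φ u z' - layer φ w z‖ ≤ ‖z' - z‖ +
      (√(Fintype.card ι : ℝ))⁻¹ * (2 / W * frob (fun i => u i - w i) * ‖z‖) :=
  (norm_mapVec_sub_le hφ h1 _ _).trans (norm_preact_sub_le hW hw u z z')

theorem norm_layerDeriv_le (h1 : ∀ t, |deriv φ t| ≤ 1)
    (hW : 0 < W) (hw : ∀ i, W ≤ ‖w i‖) (h : ι → V) (z dz : V) :
    ‖layerDeriv φ w z (h, dz)‖ ≤ ‖dz‖ +
      (√(Fintype.card ι : ℝ))⁻¹ * (2 / W * frob h * ‖z‖) :=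
  (norm_mapVecDeriv_le h1 _ _).trans (norm_preactDeriv_le hW hw h z dz)

theorem norm_layer_sub_sub_le (hφ : Differentiable ℝ φ) (hφ' : Differentiable ℝ (deriv φ))
    (h1 : ∀ t, |deriv φ t| ≤ 1) (h2 : ∀ t, |deriv (deriv φ) t| ≤ β)
    (hW : 0 < W) (hw : ∀ i, W ≤ ‖w i‖) (u : ι → V) (z z' dz : V) :
    ‖layer φ u z' - layer φ w z - layerDeriv φ w z (fun i => u i - w i, dz)‖ ≤
      β * (‖z' - z‖ +
        (√(Fintype.card ι : ℝ))⁻¹ * (2 / W * frob (fun i => u i - w i) * ‖z‖)) ^ 2 +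
      (‖z' - z - dz‖ +
      (√(Fintype.card ι : ℝ))⁻¹ * (3 / W ^ 2 * frob (fun i => u i - w i) ^ 2 * ‖z‖) +
      (√(Fintype.card ι : ℝ))⁻¹ * (2 / W * frob (fun i => u i - w i) * ‖z' - z‖)) := by
  have hβ : 0 ≤ β := (abs_nonneg _).trans (h2 0)
  have key : layer φ u z' - layer φ w z - layerDeriv φ w z (fun i => u i - w i, dz) =
      (mapVec φ (preact u z') - mapVec φ (preact w z) -
        mapVecDeriv φ (preact w z) (preact u z' - preact w z)) +
      mapVecDeriv φ (preact w z)
        (preact u z' - preact w z - preactDeriv w z (fun i => u i - w i, dz)) := by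
    rw [map_sub _ (preact u z' - preact w z)]
    simp only [layer, layerDeriv, LinearMap.comp_apply]
    abel
  rw [key]
  refine (norm_add_le _ _).trans (add_le_add ?_ ?_)
  · refine (norm_mapVec_sub_sub_le hφ hφ' h2 _ _).trans ?_
    gcongr
    exact norm_preact_sub_le hW hw u z z'
  · exact (norm_mapVecDeriv_le h1 _ _).trans (norm_preact_sub_sub_le hW hw u z z' dz)

end Layer

/-! ### Expansion of the activations through the depth -/

section Network

variable {w : ℕ → ℕ} {L : ℕ}

/-- The rows of the weight matrix of a layer, as a linear map. -/
noncomputable def rowsLin (l : Fin L) :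
    Param w L →ₗ[ℝ] (Fin (w (l + 1)) → EuclideanSpace ℝ (Fin (w l))) where
  toFun θ := row θ l
  map_add' _ _ := rfl
  map_smul' _ _ := rfl

/-- The output vector, as a linear map. -/
noncomputable def outVecLin : Param w L →ₗ[ℝ] EuclideanSpace ℝ (Fin (w L)) where
  toFun θ := outVec θ
  map_add' _ _ := rfl
  map_smul' _ _ := rfl

/-- The Frobenius norm of the weight matrix of layer `k + 1`. -/
noncomputable def layerNorm (δ : Param w L) (k : ℕ) : ℝ :=
  if h : k < L then frob (row δ ⟨k, h⟩) else 0

theorem layerNorm_of_lt (δ : Param w L) {k : ℕ} (h : k < L) :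
    layerNorm δ k = frob (row δ ⟨k, h⟩) := dif_pos h

theorem layerNorm_nonneg (δ : Param w L) (k : ℕ) : 0 ≤ layerNorm δ k := by
  unfold layerNorm
  split_ifs
  · exact frob_nonneg _
  · exact le_rfl

theorem sum_layerNorm_sq_add (δ : Param w L) :
    ∑ k ∈ Finset.range L, layerNorm δ k ^ 2 + ‖outVec δ‖ ^ 2 = ‖δ‖ ^ 2 := by
  rw [Finset.sum_range, EuclideanSpace.norm_sq_eq δ, Fintype.sum_sum_type, Fintype.sum_sigma,
    EuclideanSpace.norm_sq_eq]
  congr 1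
  refine Finset.sum_congr rfl fun k _ => ?_
  rw [layerNorm_of_lt δ k.2, frob, EuclideanSpace.norm_sq_eq, Fintype.sum_prod_type]
  refine Finset.sum_congr rfl fun i _ => ?_
  simp only [norm_norm]
  rw [EuclideanSpace.norm_sq_eq]
  rfl

theorem norm_outVec_le (δ : Param w L) : ‖outVec δ‖ ≤ ‖δ‖ := by
  refine pow_le_pow_iff_left₀ (norm_nonneg _) (norm_nonneg _) two_ne_zero |>.1 ?_
  rw [← sum_layerNorm_sq_add δ]
  exact le_add_of_nonneg_left (Finset.sum_nonneg fun _ _ => sq_nonneg _)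

theorem sum_layerNorm_sq_le (δ : Param w L) :
    ∑ k ∈ Finset.range L, layerNorm δ k ^ 2 ≤ ‖δ‖ ^ 2 := by
  rw [← sum_layerNorm_sq_add δ]
  exact le_add_of_nonneg_right (sq_nonneg _)

theorem layerNorm_le {k : ℕ} (hk : k < L) (δ : Param w L) : layerNorm δ k ≤ ‖δ‖ := by
  refine pow_le_pow_iff_left₀ (layerNorm_nonneg δ k) (norm_nonneg _) two_ne_zero |>.1 ?_
  refine le_trans ?_ (sum_layerNorm_sq_le δ)
  exact Finset.single_le_sum (f := fun k => layerNorm δ k ^ 2) (fun _ _ => sq_nonneg _)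
    (Finset.mem_range.2 hk)

/-- Cauchy–Schwarz over the layers; this is the source of every `√L`. -/
theorem sum_layerNorm_le {l : ℕ} (hl : l ≤ L) (δ : Param w L) :
    ∑ k ∈ Finset.range l, layerNorm δ k ≤ √(L : ℝ) * ‖δ‖ := by
  calc ∑ k ∈ Finset.range l, layerNorm δ k ≤ ∑ k ∈ Finset.range L, layerNorm δ k :=
        Finset.sum_le_sum_of_subset_of_nonneg (Finset.range_mono hl)
          fun _ _ _ => layerNorm_nonneg _ _
    _ ≤ √(L : ℝ) * ‖δ‖ := by
        refine pow_le_pow_iff_left₀ (Finset.sum_nonneg fun _ _ => layerNorm_nonneg _ _)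
          (by positivity) two_ne_zero |>.1 ?_
        rw [mul_pow, Real.sq_sqrt (Nat.cast_nonneg _)]
        refine (sq_sum_le_card_mul_sum_sq).trans ?_
        rw [Finset.card_range]
        gcongr
        exact sum_layerNorm_sq_le δ

theorem act_succ (φ : ℝ → ℝ) (θ : Param w L) (x : EuclideanSpace ℝ (Fin (w 0))) (l : ℕ)
    (h : l + 1 ≤ L) :
    act φ θ x (l + 1) h = layer φ (row θ ⟨l, h⟩) (act φ θ x l (Nat.le_of_succ_le h)) := by
  ext i
  simp [act, layer, mapVec, preact, rowsMul, unitVec, inner_smul_left, div_eq_inv_mul]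

variable {φ : ℝ → ℝ} {β : ℝ} {m : ℕ}

theorem norm_act_le (hφ : Differentiable ℝ φ) (h1 : ∀ t, |deriv φ t| ≤ 1)
    (hm : ∀ l, 1 ≤ l → l ≤ L → w l = m) (θ : Param w L) {x : EuclideanSpace ℝ (Fin (w 0))}
    (hx : ‖x‖ = 1) (l : ℕ) (hl : l ≤ L) :
    ‖act φ θ x l hl‖ ≤ 1 + l * |φ 0| * √(m : ℝ) := by
  induction l with
  | zero => simp [act, hx]
  | succ l ih =>
    rw [act_succ]
    refine (norm_layer_le hφ h1 _ _).trans ?_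
    rw [Fintype.card_fin, hm (l + 1) (Nat.succ_pos l) hl]
    have := ih (Nat.le_of_succ_le hl)
    push_cast
    linarith

/-- The first order expansion of the activations at a point all of whose rows have norm at
least `W`, with a quadratic remainder. -/
theorem exists_act_expansion (hφ : Differentiable ℝ φ) (hφ' : Differentiable ℝ (deriv φ))
    (h1 : ∀ t, |deriv φ t| ≤ 1) (h2 : ∀ t, |deriv (deriv φ) t| ≤ β)
    (hm : ∀ l, 1 ≤ l → l ≤ L → w l = m) {θ : Param w L} {W : ℝ} (hW : 0 < W)
    (hθ : ∀ l i, W ≤ ‖row θ l i‖) {x : EuclideanSpace ℝ (Fin (w 0))} {b K : ℝ}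
    (hb : ∀ l hl, ‖act φ θ x l hl‖ ≤ b) (hK : (√(m : ℝ))⁻¹ * (2 / W * b) = K)
    (l : ℕ) (hl : l ≤ L) :
    ∃ D : Param w L →ₗ[ℝ] EuclideanSpace ℝ (Fin (w l)), ∀ θ' : Param w L,
      ‖act φ θ' x l hl - act φ θ x l hl‖ ≤
        K * ∑ k ∈ Finset.range l, layerNorm (θ' - θ) k ∧
      ‖D (θ' - θ)‖ ≤ K * ∑ k ∈ Finset.range l, layerNorm (θ' - θ) k ∧
      ‖act φ θ' x l hl - act φ θ x l hl - D (θ' - θ)‖ ≤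
        l * ((β * (K * √(L : ℝ)) ^ 2 + (√(m : ℝ))⁻¹ * (3 / W ^ 2 * b) +
          (√(m : ℝ))⁻¹ * (2 / W * (K * √(L : ℝ)))) * ‖θ' - θ‖ ^ 2) := by
  have hβ : 0 ≤ β := (abs_nonneg _).trans (h2 0)
  have hb0 : 0 ≤ b := (norm_nonneg _).trans (hb 0 (Nat.zero_le L))
  have hK0 : 0 ≤ K := by rw [← hK]; positivity
  induction l with
  | zero => exact ⟨0, fun θ' => by simp [act]⟩
  | succ l ih =>
    obtain ⟨D, hD⟩ := ih (Nat.le_of_succ_le hl)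
    -- The chain rule: the layer derivative applied to the row increments and the previous
    -- derivative `D`.
    refine ⟨layerDeriv φ (row θ ⟨l, hl⟩) (act φ θ x l (Nat.le_of_succ_le hl)) ∘ₗ
      (rowsLin ⟨l, hl⟩).prod D, fun θ' => ?_⟩
    obtain ⟨hA, hD1, hE⟩ := hD θ'
    have hcard : (Fintype.card (Fin (w (l + 1))) : ℝ) = m := by
      rw [Fintype.card_fin, hm (l + 1) (Nat.succ_pos l) hl]
    have hrow : (fun i => row θ' ⟨l, hl⟩ i - row θ ⟨l, hl⟩ i) = row (θ' - θ) ⟨l, hl⟩ := rfl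
    have hln := layerNorm_of_lt (θ' - θ) hl
    have hl0 := layerNorm_nonneg (θ' - θ) l
    have hlt := layerNorm_le hl (θ' - θ)
    have hz := hb l (Nat.le_of_succ_le hl)
    -- A layer passes on the incoming change with factor 1 and adds `K` times its own weight change.
    have hstep : ∀ t, t ≤ K * ∑ k ∈ Finset.range l, layerNorm (θ' - θ) k →
        t + (√(m : ℝ))⁻¹ * (2 / W * layerNorm (θ' - θ) l *
          ‖act φ θ x l (Nat.le_of_succ_le hl)‖) ≤
        K * ∑ k ∈ Finset.range (l + 1), layerNorm (θ' - θ) k := by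
      intro t ht
      rw [Finset.sum_range_succ, mul_add]
      refine add_le_add ht ?_
      calc _ ≤ (√(m : ℝ))⁻¹ * (2 / W * layerNorm (θ' - θ) l * b) := by gcongr
        _ = K * layerNorm (θ' - θ) l := by rw [← hK]; ring
    rw [act_succ, act_succ]
    refine ⟨?_, ?_, ?_⟩
    · refine (norm_layer_sub_le hφ h1 hW (hθ ⟨l, hl⟩) _ _ _).trans ?_
      rw [hcard, hrow, ← hln]
      exact hstep _ hA
    · refine (norm_layerDeriv_le h1 hW (hθ ⟨l, hl⟩) _ _ _).trans ?_
      change _ + _ * (2 / W * frob (row (θ' - θ) ⟨l, hl⟩) * _) ≤ _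
      rw [hcard, ← hln]
      exact hstep _ hD1
    · refine (norm_layer_sub_sub_le hφ hφ' h1 h2 hW (hθ ⟨l, hl⟩) _ _ _
        (D (θ' - θ))).trans ?_
      rw [hcard, hrow, ← hln]
      have e1 := (hstep _ hA).trans
        (mul_le_mul_of_nonneg_left (sum_layerNorm_le hl (θ' - θ)) hK0)
      have e2 := hA.trans
        (mul_le_mul_of_nonneg_left (sum_layerNorm_le (Nat.le_of_succ_le hl) (θ' - θ)) hK0)
      -- Besides the inherited error, each layer adds the same amount: curvature of `φ`, curvature
      -- of the normalization, and the weight–input cross term.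
      calc _ ≤ β * (K * (√(L : ℝ) * ‖θ' - θ‖)) ^ 2 + (
            l * ((β * (K * √(L : ℝ)) ^ 2 + (√(m : ℝ))⁻¹ * (3 / W ^ 2 * b) +
              (√(m : ℝ))⁻¹ * (2 / W * (K * √(L : ℝ)))) * ‖θ' - θ‖ ^ 2) +
            (√(m : ℝ))⁻¹ * (3 / W ^ 2 * ‖θ' - θ‖ ^ 2 * b) +
            (√(m : ℝ))⁻¹ * (2 / W * ‖θ' - θ‖ * (K * (√(L : ℝ) * ‖θ' - θ‖)))) := by
            gcongr
        _ = _ := by push_cast; ring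

end Network

/-! ### Restricted strong convexity of an abstract square loss -/

section SquareLoss

variable {E : Type*} [NormedAddCommGroup E]

theorem hasFDerivAt_of_quadratic_remainder [NormedSpace ℝ E] {f : E → ℝ} {g : E →L[ℝ] ℝ} {θ : E}
    {R : ℝ} (h : ∀ θ', |f θ' - f θ - g (θ' - θ)| ≤ R * ‖θ' - θ‖ ^ 2) : HasFDerivAt f g θ := by
  refine .of_isLittleO (Asymptotics.IsBigO.trans_isLittleO (g := fun θ' => ‖θ' - θ‖ ^ 2) ?_ ?_)
  · exact Asymptotics.IsBigO.of_bound R (.of_forall fun θ' => by simpa using h θ')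
  · exact Asymptotics.isLittleO_pow_sub_sub θ one_lt_two

variable [InnerProductSpace ℝ E] [CompleteSpace E]

/-- Restricted strong convexity of the square loss, for predictors with a first order expansion
at `θ` whose remainder is quadratic on the whole space. -/
theorem squareLoss_restricted_strong_convexity {n : ℕ} {f : Fin n → E → ℝ} {g : Fin n → E →L[ℝ] ℝ}
    {θ : E} {R G B κ : ℝ} {y : Fin n → ℝ} {F : E → ℝ}
    (hF : ∀ θ, F θ = (1 / (n : ℝ)) * ∑ i, (y i - f i θ) ^ 2)
    (hf : ∀ i θ', |f i θ' - f i θ - g i (θ' - θ)| ≤ R * ‖θ' - θ‖ ^ 2)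
    (hg : ∀ i h, |g i h| ≤ G * ‖h‖) (hR : 0 ≤ R)
    (hB : (1 / (n : ℝ)) * ∑ i, |y i - f i θ| ≤ B) (hκ : 0 < κ) (hG : 0 ≤ G) :
    DifferentiableAt ℝ F θ ∧
    ∀ θ', κ ≤ |Real.cos (InnerProductGeometry.angle (θ' - θ) (gradient F θ))| →
      F θ + inner ℝ (θ' - θ) (gradient F θ) +
        (κ ^ 2 / 2 * (‖gradient F θ‖ ^ 2 / F θ) - 4 * (R * (G * ‖θ' - θ‖ + B))) / 2 *
          ‖θ' - θ‖ ^ 2 ≤ F θ' := by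
  have hF' : HasFDerivAt F ((1 / (n : ℝ)) • ∑ i, (-(2 * (y i - f i θ))) • g i) θ := by
    have h0 : F = fun θ => (1 / (n : ℝ)) * ∑ i, (y i - f i θ) ^ 2 := funext hF
    rw [h0]
    refine HasFDerivAt.const_mul (HasFDerivAt.fun_sum fun i _ => ?_) _
    have := ((hasFDerivAt_of_quadratic_remainder (hf i)).const_sub (y i)).pow 2
    refine this.congr_fderiv ?_
    ext h
    simp
  refine ⟨hF'.differentiableAt, fun θ' hθ' => ?_⟩
  have hin : inner ℝ (θ' - θ) (gradient F θ) =
      (1 / (n : ℝ)) * ∑ i, -(2 * (y i - f i θ)) * g i (θ' - θ) := by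
    rw [real_inner_comm, gradient, InnerProductSpace.toDual_symm_apply, hF'.fderiv]
    simp
  set t := ‖θ' - θ‖ with ht
  have ht0 : 0 ≤ t := norm_nonneg _
  set I := inner ℝ (θ' - θ) (gradient F θ) with hI
  set A := (1 / (n : ℝ)) * ∑ i, g i (θ' - θ) ^ 2 with hA
  have hn : 0 ≤ 1 / (n : ℝ) := by positivity
  have hA0 : 0 ≤ A := mul_nonneg hn (Finset.sum_nonneg fun _ _ => sq_nonneg _)
  have hF0 : 0 ≤ F θ := by
    rw [hF]; exact mul_nonneg hn (Finset.sum_nonneg fun _ _ => sq_nonneg _)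
  have hcs : I ^ 2 ≤ 4 * F θ * A := by
    have h := Finset.sum_mul_sq_le_sq_mul_sq Finset.univ (fun i => y i - f i θ)
      (fun i => g i (θ' - θ))
    have h2 : I = -2 * ((1 / (n : ℝ)) * ∑ i, (y i - f i θ) * g i (θ' - θ)) := by
      rw [hin, mul_left_comm, Finset.mul_sum Finset.univ _ (-2 : ℝ)]
      congr 1
      exact Finset.sum_congr rfl fun i _ => by ring
    rw [h2, hF, hA]
    calc _ = 4 * (1 / (n : ℝ)) ^ 2 * (∑ i, (y i - f i θ) * g i (θ' - θ)) ^ 2 := by ring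
      _ ≤ 4 * (1 / (n : ℝ)) ^ 2 * ((∑ i, (y i - f i θ) ^ 2) * ∑ i, g i (θ' - θ) ^ 2) := by gcongr
      _ = _ := by ring
  have hcos : κ * (t * ‖gradient F θ‖) ≤ |I| := by
    rw [hI, ← InnerProductGeometry.cos_angle_mul_norm_mul_norm, abs_mul,
      abs_of_nonneg (a := ‖θ' - θ‖ * _) (by positivity)]
    gcongr
  have hmain : κ ^ 2 / 2 * (‖gradient F θ‖ ^ 2 / F θ) / 2 * t ^ 2 ≤ A := by
    -- If `F θ = 0`, the quotient is `0` by convention and the bound reduces to `0 ≤ A`.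
    rcases hF0.eq_or_lt with h0 | h0
    · rw [← h0]; simpa using hA0
    · have h1 : (κ * (t * ‖gradient F θ‖)) ^ 2 ≤ 4 * F θ * A := by
        refine le_trans ?_ hcs
        rw [← sq_abs I]
        exact pow_le_pow_left₀ (by positivity) hcos 2
      calc _ = (κ * (t * ‖gradient F θ‖)) ^ 2 / (4 * F θ) := by field_simp; ring
        _ ≤ A := by rw [div_le_iff₀ (by positivity)]; linarith
  -- Expand `(r - g - e)²`, discard `e²`, and bound both cross terms with `|e| ≤ R t²`.
  have hpt : ∀ i, (y i - f i θ) ^ 2 + -(2 * (y i - f i θ)) * g i (θ' - θ) + g i (θ' - θ) ^ 2 -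
      2 * (R * t ^ 2) * (G * t) - 2 * (R * t ^ 2) * |y i - f i θ| ≤ (y i - f i θ') ^ 2 := by
    intro i
    set r := y i - f i θ
    set e := f i θ' - f i θ - g i (θ' - θ) with he
    have h1 : |r * e| ≤ |r| * (R * t ^ 2) := by rw [abs_mul]; gcongr; exact hf i θ'
    have h2 : |g i (θ' - θ) * e| ≤ (G * t) * (R * t ^ 2) := by
      rw [abs_mul]; gcongr; exacts [hg i _, hf i θ']
    have h3 : y i - f i θ' = r - g i (θ' - θ) - e := by simp only [r, he]; ring
    rw [h3]
    nlinarith [le_abs_self (r * e), neg_abs_le (g i (θ' - θ) * e), sq_nonneg e]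
  have hsum := mul_le_mul_of_nonneg_left
    (Finset.sum_le_sum fun i (_ : i ∈ Finset.univ) => hpt i) hn
  simp only [Finset.sum_sub_distrib, Finset.sum_add_distrib, ← Finset.mul_sum,
    Finset.sum_const, Finset.card_univ, Fintype.card_fin, nsmul_eq_mul] at hsum
  rw [mul_sub, mul_sub, mul_add, mul_add, ← hF, ← hF, ← hin, ← hA] at hsum
  -- Only an inequality, so that `n = 0` is covered.
  have hn1 : 1 / (n : ℝ) * (n * (2 * (R * t ^ 2) * (G * t))) ≤ 2 * (R * t ^ 2) * (G * t) := by
    rw [← mul_assoc, one_div]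
    exact mul_le_of_le_one_left (by positivity) inv_mul_le_one
  have hB' : 1 / (n : ℝ) * (2 * (R * t ^ 2) * ∑ i, |y i - f i θ|) ≤ 2 * (R * t ^ 2) * B := by
    rw [mul_left_comm]
    gcongr
  linarith

end SquareLoss

/-! ### Expansion of the predictor -/

section Predictor

variable {w : ℕ → ℕ} {L : ℕ} {φ : ℝ → ℝ} {β : ℝ} {m : ℕ}

theorem exists_predictor_expansion (hφ : Differentiable ℝ φ) (hφ' : Differentiable ℝ (deriv φ))
    (h1 : ∀ t, |deriv φ t| ≤ 1) (h2 : ∀ t, |deriv (deriv φ) t| ≤ β)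
    (hm : ∀ l, 1 ≤ l → l ≤ L → w l = m) {θ : Param w L} {W : ℝ} (hW : 0 < W)
    (hθ : ∀ l i, W ≤ ‖row θ l i‖) {x : EuclideanSpace ℝ (Fin (w 0))} {b K V : ℝ}
    (hb : ∀ l hl, ‖act φ θ x l hl‖ ≤ b) (hK : (√(m : ℝ))⁻¹ * (2 / W * b) = K)
    (hV : ‖outVec θ‖ ≤ V) :
    ∃ g : Param w L →L[ℝ] ℝ, (∀ h, |g h| ≤ (b + V * (K * √(L : ℝ))) * ‖h‖) ∧
      ∀ θ', |predictor φ θ' x - predictor φ θ x - g (θ' - θ)| ≤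
        (V * (L * (β * (K * √(L : ℝ)) ^ 2 + (√(m : ℝ))⁻¹ * (3 / W ^ 2 * b) +
          (√(m : ℝ))⁻¹ * (2 / W * (K * √(L : ℝ))))) + K * √(L : ℝ)) * ‖θ' - θ‖ ^ 2 := by
  have hb0 : 0 ≤ b := (norm_nonneg _).trans (hb 0 (Nat.zero_le L))
  have hK0 : 0 ≤ K := by rw [← hK]; positivity
  have hV0 : 0 ≤ V := (norm_nonneg _).trans hV
  obtain ⟨D, hD⟩ := exists_act_expansion hφ hφ' h1 h2 hm hW hθ hb hK L le_rfl
  have hα := hb L le_rfl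
  set α := act φ θ x L le_rfl
  have hS : ∀ δ : Param w L, K * ∑ k ∈ Finset.range L, layerNorm δ k ≤ K * √(L : ℝ) * ‖δ‖ :=
    fun δ => by rw [mul_assoc]; gcongr; exact sum_layerNorm_le le_rfl δ
  refine ⟨((innerₛₗ ℝ α ∘ₗ outVecLin) + (innerₛₗ ℝ (outVec θ) ∘ₗ D)).toContinuousLinearMap,
    fun h => ?_, fun θ' => ?_⟩
  · have hDh : ‖D h‖ ≤ K * √(L : ℝ) * ‖h‖ := by
      have := (hD (θ + h)).2.1
      rw [add_sub_cancel_left] at this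
      exact this.trans (hS h)
    change |inner ℝ α (outVec h) + inner ℝ (outVec θ) (D h)| ≤ _
    calc _ ≤ ‖α‖ * ‖outVec h‖ + ‖outVec θ‖ * ‖D h‖ :=
          (abs_add_le _ _).trans
            (add_le_add (abs_real_inner_le_norm _ _) (abs_real_inner_le_norm _ _))
      _ ≤ b * ‖h‖ + V * (K * √(L : ℝ) * ‖h‖) := by gcongr; exact norm_outVec_le h
      _ = _ := by ring
  · obtain ⟨hA, -, hE⟩ := hD θ'
    have hA' := hA.trans (hS _)
    set α' := act φ θ' x L le_rfl
    have key : predictor φ θ' x - predictor φ θ x -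
        (inner ℝ α (outVec (θ' - θ)) + inner ℝ (outVec θ) (D (θ' - θ))) =
        -- Product rule for `⟪v, α⟫`: only the output vector at `θ` multiplies the remainder, and
        -- the cross term is a product of two first order changes.
        inner ℝ (outVec θ) (α' - α - D (θ' - θ)) + inner ℝ (outVec (θ' - θ)) (α' - α) := by
      have ho : outVec (θ' - θ) = outVec θ' - outVec θ := rfl
      have e1 : predictor φ θ' x = inner ℝ (outVec θ') α' := rfl
      have e2 : predictor φ θ x = inner ℝ (outVec θ) α := rfl
      rw [e1, e2, ho]
      simp only [inner_sub_right, inner_sub_left, real_inner_comm α]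
      ring
    change |predictor φ θ' x - predictor φ θ x -
        (inner ℝ α (outVec (θ' - θ)) + inner ℝ (outVec θ) (D (θ' - θ)))| ≤ _
    rw [key]
    calc _ ≤ ‖outVec θ‖ * ‖α' - α - D (θ' - θ)‖ + ‖outVec (θ' - θ)‖ * ‖α' - α‖ :=
          (abs_add_le _ _).trans
            (add_le_add (abs_real_inner_le_norm _ _) (abs_real_inner_le_norm _ _))
      _ ≤ V * (L * ((β * (K * √(L : ℝ)) ^ 2 + (√(m : ℝ))⁻¹ * (3 / W ^ 2 * b) +
          (√(m : ℝ))⁻¹ * (2 / W * (K * √(L : ℝ)))) * ‖θ' - θ‖ ^ 2)) +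
          ‖θ' - θ‖ * (K * √(L : ℝ) * ‖θ' - θ‖) := by gcongr; exact norm_outVec_le _
      _ = _ := by ring

theorem minRowNorm_le (θ : Param w L) (l : Fin L) (i : Fin (w (l + 1))) :
    minRowNorm θ ≤ ‖row θ l i‖ :=
  ciInf_le (f := fun p : Σ l : Fin L, Fin (w (l + 1)) => ‖row θ p.1 p.2‖)
    (Set.finite_range _).bddBelow ⟨l, i⟩

theorem minRowNorm_pos [Nonempty (Σ l : Fin L, Fin (w (l + 1)))] {θ : Param w L}
    (hθ : ∀ l i, row θ l i ≠ 0) : 0 < minRowNorm θ := by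
  obtain ⟨p, hp⟩ := exists_eq_ciInf_of_finite
    (f := fun p : Σ l : Fin L, Fin (w (l + 1)) => ‖row θ p.1 p.2‖)
  rw [minRowNorm, ← hp]
  exact norm_pos_iff.2 (hθ _ _)

end Predictor

/-! ### Bookkeeping of constants -/

section Constants

/-- The bound on the remainder of the predictor, in terms of `r = 1 / √m`, `s = √L` and
`p = r * b`. -/
theorem remainder_le {β ρ r s Λ p G W V K : ℝ} (hβ : 0 ≤ β) (hρ : 0 ≤ ρ) (hr : 0 ≤ r)
    (hr1 : r ≤ 1) (hs : 1 ≤ s) (hΛ : s ^ 2 = Λ) (hp : 0 ≤ p) (hpG : p ≤ G) (hpG2 : p ^ 2 ≤ 2 * G)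
    (hW : 0 < W) (hV : V = 1 + ρ) (hK : K = 2 / W * p) :
    V * (Λ * (β * (K * s) ^ 2 + 3 / W ^ 2 * p + r * (2 / W * (K * s)))) + K * s ≤
      (9 + 8 * β) * ((1 + ρ) * Λ ^ 3 * G / min W (W ^ 2)) := by
  have hN : 0 < min W (W ^ 2) := lt_min hW (by positivity)
  set q := 1 / min W (W ^ 2) with hq
  have hq0 : 0 ≤ q := by positivity
  have hW1 : 1 / W ≤ q := one_div_le_one_div_of_le hN (min_le_left _ _)
  have hW2 : 1 / W ^ 2 ≤ q := one_div_le_one_div_of_le hN (min_le_right _ _)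
  have hΛ1 : 1 ≤ Λ := by nlinarith
  have hsΛ : s ≤ Λ := by nlinarith
  have hG : 0 ≤ G := hp.trans hpG
  have hrp : r * p ≤ G := (mul_le_of_le_one_left hp hr1).trans hpG
  -- `G` controls `p`, `p²` and `r * p`, and `q` controls both powers of `1 / W`. The three terms
  -- contribute `8β`, `3` and `4`; the final `K * s` adds `2`, which makes `9 + 8β`.
  have hM : β * (K * s) ^ 2 + 3 / W ^ 2 * p + r * (2 / W * (K * s)) ≤
      (7 + 8 * β) * (Λ * G * q) := by
    calc _ = (4 * β * Λ * p ^ 2 + 3 * p + 4 * s * (r * p)) * (1 / W ^ 2) := by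
          rw [hK, ← hΛ]; ring
      _ ≤ (4 * β * Λ * (2 * G) + 3 * (Λ * G) + 4 * Λ * G) * q := by
          gcongr
          exact hpG.trans (le_mul_of_one_le_left hG hΛ1)
      _ = _ := by ring
  have hX : 0 ≤ Λ * G * q := by positivity
  have hKs : K * s ≤ 2 * (Λ * G * q) := by
    calc K * s = 2 * (s * p * (1 / W)) := by rw [hK]; ring
      _ ≤ _ := by gcongr
  have hX3 : Λ * (Λ * G * q) ≤ Λ ^ 3 * G * q := by
    calc _ = Λ ^ 2 * (G * q) := by ring
      _ ≤ Λ ^ 3 * (G * q) := by gcongr; norm_num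
      _ = _ := by ring
  have hX2 : Λ * G * q ≤ Λ ^ 3 * G * q := (le_mul_of_one_le_left hX hΛ1).trans hX3
  calc _ ≤ (1 + ρ) * (Λ * ((7 + 8 * β) * (Λ * G * q))) + 2 * (Λ * G * q) := by
        rw [hV]; gcongr
    _ = (1 + ρ) * (7 + 8 * β) * (Λ * (Λ * G * q)) + 2 * (Λ * G * q) := by ring
    _ ≤ (1 + ρ) * (7 + 8 * β) * (Λ ^ 3 * G * q) + 2 * ((1 + ρ) * (Λ ^ 3 * G * q)) := by
        have h3 := mul_le_mul_of_nonneg_left hX3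
          (show 0 ≤ (1 + ρ) * (7 + 8 * β) by positivity)
        have h4 : Λ * G * q ≤ (1 + ρ) * (Λ ^ 3 * G * q) :=
          hX2.trans (le_mul_of_one_le_left (by positivity) (by linarith))
        linarith
    _ = _ := by rw [hq]; ring

/-- Bounds the factor `G * ‖θ' - θ‖ + B` of the abstract correction. Everything is compared with `X
≥ 1`: the slope is at most `2X`, the residual at most `(2 + Y²) X`. -/
theorem slope_add_residual_le {ρ₁ ρ₂ t b q Y : ℝ} (h1 : 0 ≤ ρ₁) (ht : 0 ≤ t) (h2 : t ≤ ρ₂)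
    (hb : 1 ≤ b) (hq : 0 ≤ q) :
    (b + (1 + ρ₁) * (2 * b * q)) * t + ((1 + Y ^ 2) / 2 + (1 + ρ₁) * b) ≤
      (3 + Y ^ 2) * ((1 + ρ₂) * (1 + ρ₁) * b * (1 + q)) := by
  have hρ : 0 ≤ ρ₂ := ht.trans h2
  have hY := sq_nonneg Y
  set X := (1 + ρ₁) * b * (1 + q) with hX
  have hbX : b ≤ X := by
    calc b = 1 * b * 1 := by ring
      _ ≤ X := by rw [hX]; gcongr <;> linarith
  have hX1 : 1 ≤ X := hb.trans hbX
  have hX2 : b + (1 + ρ₁) * (2 * b * q) ≤ 2 * X := by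
    have : 0 ≤ ρ₁ * b := by positivity
    rw [hX]; nlinarith
  have hX3 : (1 + ρ₁) * b ≤ X := le_mul_of_one_le_right (by positivity) (by linarith)
  calc _ ≤ 2 * X * ρ₂ + ((1 + Y ^ 2) * X + X) := by
        gcongr
        nlinarith
    _ ≤ (3 + Y ^ 2) * ((1 + ρ₂) * X) := by
        have : 0 ≤ X * ρ₂ := by positivity
        have : 0 ≤ X * ρ₂ * Y ^ 2 := by positivity
        nlinarith
    _ = _ := by rw [hX]; ring

end Constants

/-! ### The network loss with explicit constants -/

section Bound

variable {w : ℕ → ℕ} {L m n : ℕ} {φ : ℝ → ℝ} {β Y : ℝ}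

/-- The common form of the two correction terms; `a = |φ(0)|` and `W` is the minimum weight
vector norm. -/
noncomputable def sharpCorrection (m L : ℕ) (ρ₁ ρ₂ a W : ℝ) : ℝ :=
  (1 + √(L : ℝ) * (√(m : ℝ))⁻¹ / W) *
    ((1 + ρ₂) * (1 + ρ₁) ^ 2 * (L : ℝ) ^ 3 * ((√(m : ℝ))⁻¹ + (L : ℝ) ^ 2 * max a (a ^ 2)) *
      (1 + (L : ℝ) * a * √(m : ℝ)) / min W (W ^ 2))

theorem sharpCorrection_le_correction (hm : 1 ≤ m) {ρ₁ ρ₂ a W : ℝ} (h1 : 0 ≤ ρ₁) (h2 : 0 ≤ ρ₂)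
    (ha : 0 ≤ a) (hW : 0 < W) : sharpCorrection m L ρ₁ ρ₂ a W ≤ correction m L ρ₁ ρ₂ a W := by
  have hm1 : 1 ≤ √(m : ℝ) := Real.one_le_sqrt.2 (by exact_mod_cast hm)
  have hN : 0 < min W (W ^ 2) := lt_min hW (by positivity)
  have hmax : 0 ≤ max a (a ^ 2) := ha.trans (le_max_left _ _)
  rw [sharpCorrection, correction, ← one_div (√(m : ℝ))]
  gcongr
  · exact mul_le_of_le_one_right (Real.sqrt_nonneg _)
      ((div_le_one₀ (zero_lt_one.trans_le hm1)).2 hm1)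
  · linarith
  · norm_num

theorem sharpCorrection_zero_le (hm : 1 ≤ m) {ρ₁ ρ₂ W : ℝ} (h1 : 0 ≤ ρ₁) (h2 : 0 ≤ ρ₂)
    (hW : 0 < W) : sharpCorrection m L ρ₁ ρ₂ 0 W ≤ correctionZero m L ρ₁ ρ₂ W := by
  have hm0 : 0 < √(m : ℝ) := Real.sqrt_pos.2 (by exact_mod_cast hm)
  have hN : 0 < min W (W ^ 2) := lt_min hW (by positivity)
  have e : correctionZero m L ρ₁ ρ₂ W = (1 + √(L : ℝ) * (√(m : ℝ))⁻¹ / W) *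
      ((1 + ρ₂) * (1 + ρ₁) ^ 3 * (L : ℝ) ^ 3 * (√(m : ℝ))⁻¹ / min W (W ^ 2)) := by
    rw [correctionZero]; field_simp
  have e' : sharpCorrection m L ρ₁ ρ₂ 0 W = (1 + √(L : ℝ) * (√(m : ℝ))⁻¹ / W) *
      ((1 + ρ₂) * (1 + ρ₁) ^ 2 * (L : ℝ) ^ 3 * (√(m : ℝ))⁻¹ / min W (W ^ 2)) := by
    simp [sharpCorrection]
  rw [e, e']
  gcongr
  · linarith
  · norm_num

/-- The free upper bound `E` lets one estimate serve both correction terms. -/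
theorem empLoss_restricted_strong_convexity (hL : 1 ≤ L) (hm : ∀ l, 1 ≤ l → l ≤ L → w l = m)
    (hm1 : 1 ≤ m) (hφ : Differentiable ℝ φ) (hφ' : Differentiable ℝ (deriv φ))
    (h1 : ∀ t, |deriv φ t| ≤ 1) (h2 : ∀ t, |deriv (deriv φ) t| ≤ β)
    {x : Fin n → EuclideanSpace ℝ (Fin (w 0))} {y : Fin n → ℝ} (hx : ∀ i, ‖x i‖ = 1)
    (hy : (1 / (n : ℝ)) * ∑ i, y i ^ 2 ≤ Y ^ 2) {κ ρ₁ ρ₂ : ℝ} (hκ : 0 < κ) (hρ₁ : 0 < ρ₁)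
    {θ : Param w L} (hθ : ∀ l i, row θ l i ≠ 0)
    (hV : ‖outVec θ‖ ≤ 1 + ρ₁) :
    0 < minRowNorm θ ∧ DifferentiableAt ℝ (empLoss φ x y) θ ∧
    ∀ θ' ∈ qSet (empLoss φ x y) κ θ ∩ Metric.closedBall θ ρ₂, ∀ E : ℝ,
      4 * (9 + 8 * β) * (3 + Y ^ 2) * sharpCorrection m L ρ₁ ρ₂ |φ 0| (minRowNorm θ) ≤ E →
      empLoss φ x y θ' ≥ empLoss φ x y θ + inner ℝ (θ' - θ) (gradient (empLoss φ x y) θ) +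
        rscParam (empLoss φ x y) κ E θ / 2 * ‖θ' - θ‖ ^ 2 := by
  have hβ : 0 ≤ β := (abs_nonneg _).trans (h2 0)
  have hne : Nonempty (Σ l : Fin L, Fin (w (l + 1))) := by
    refine ⟨⟨⟨0, hL⟩, ⟨0, ?_⟩⟩⟩
    rw [hm _ (Nat.succ_pos _) hL]; exact hm1
  have hW := minRowNorm_pos hθ
  have hWle := minRowNorm_le θ
  refine ⟨hW, ?_⟩
  generalize minRowNorm θ = W at hW hWle ⊢
  have hL1 : (1 : ℝ) ≤ L := by exact_mod_cast hL
  have hsm : 1 ≤ √(m : ℝ) := Real.one_le_sqrt.2 (by exact_mod_cast hm1)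
  have ha : 0 ≤ |φ 0| := abs_nonneg _
  set r := (√(m : ℝ))⁻¹ with hr
  set b := 1 + (L : ℝ) * |φ 0| * √(m : ℝ) with hb
  set K := r * (2 / W * b) with hK
  set G := r + (L : ℝ) ^ 2 * max |φ 0| (|φ 0| ^ 2) with hG
  have hr0 : 0 ≤ r := by positivity
  have hr1 : r ≤ 1 := inv_le_one_of_one_le₀ hsm
  have hb1 : 1 ≤ b := le_add_of_nonneg_right (by positivity)
  have hb0 : 0 ≤ b := zero_le_one.trans hb1
  have hK0 : 0 ≤ K := by positivity
  have hp : r * b = r + L * |φ 0| := by rw [hb, hr]; field_simp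
  have hpG : r * b ≤ G := by
    rw [hp, hG]
    gcongr
    · exact le_self_pow₀ hL1 two_ne_zero
    · exact le_max_left _ _
  -- The square of `r + L|φ 0|` brings in `|φ 0|²`, hence the maximum in `G`; `r² ≤ r` because `r ≤
  -- 1`.
  have hpG2 : (r * b) ^ 2 ≤ 2 * G := by
    calc (r * b) ^ 2 ≤ 2 * (r ^ 2 + (L * |φ 0|) ^ 2) := by rw [hp]; exact add_sq_le
      _ ≤ 2 * (r + (L : ℝ) ^ 2 * max |φ 0| (|φ 0| ^ 2)) := by
        rw [mul_pow]
        gcongr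
        · exact pow_le_of_le_one hr0 hr1 two_ne_zero
        · exact le_max_right _ _
  have hact : ∀ i l hl, ‖act φ θ (x i) l hl‖ ≤ b := fun i l hl => by
    refine (norm_act_le hφ h1 hm θ (hx i) l hl).trans ?_
    rw [hb]
    gcongr
  choose g hg hf using fun i =>
    exists_predictor_expansion hφ hφ' h1 h2 hm hW hWle (hact i) hK.symm hV
  set R := (1 + ρ₁) * (L * (β * (K * √(L : ℝ)) ^ 2 + r * (3 / W ^ 2 * b) +
          r * (2 / W * (K * √(L : ℝ))))) + K * √(L : ℝ) with hRdef
  have hR0 : 0 ≤ R := by positivity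
  have hRle : R ≤ (9 + 8 * β) * ((1 + ρ₁) * (L : ℝ) ^ 3 * G / min W (W ^ 2)) := by
    refine le_trans (le_of_eq ?_) (remainder_le (p := r * b) (s := √(L : ℝ)) (K := K) (r := r)
      (V := 1 + ρ₁) hβ hρ₁.le hr0 hr1 (Real.one_le_sqrt.2 hL1) (Real.sq_sqrt (by positivity))
      (by positivity) hpG hpG2 hW rfl (by rw [hK]; ring))
    rw [hRdef]; ring
  have hB : (1 / (n : ℝ)) * ∑ i, |y i - predictor φ θ (x i)| ≤
      (1 + Y ^ 2) / 2 + (1 + ρ₁) * b := by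
    have hn : 0 ≤ 1 / (n : ℝ) := by positivity
    -- `|y| ≤ (1 + y²) / 2` makes the second moment bound on the labels applicable.
    have hpt : ∀ i, |y i - predictor φ θ (x i)| ≤ y i ^ 2 / 2 + (1 / 2 + (1 + ρ₁) * b) := by
      intro i
      have hpred : |predictor φ θ (x i)| ≤ (1 + ρ₁) * b :=
        (abs_real_inner_le_norm _ _).trans (by gcongr; exact hact i _ _)
      have := abs_sub (y i) (predictor φ θ (x i))
      nlinarith [sq_nonneg (|y i| - 1), sq_abs (y i)]
    have hc0 : 0 ≤ 1 / 2 + (1 + ρ₁) * b := by positivity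
    calc _ ≤ (1 / (n : ℝ)) * ∑ i, (y i ^ 2 / 2 + (1 / 2 + (1 + ρ₁) * b)) := by
          gcongr with i; exact hpt i
      _ = (1 / (n : ℝ) * ∑ i, y i ^ 2) / 2 + (n : ℝ)⁻¹ * n * (1 / 2 + (1 + ρ₁) * b) := by
          rw [Finset.sum_add_distrib, ← Finset.sum_div, Finset.sum_const, Finset.card_univ,
            Fintype.card_fin, nsmul_eq_mul]
          ring
      _ ≤ Y ^ 2 / 2 + 1 * (1 / 2 + (1 + ρ₁) * b) := by gcongr; exact inv_mul_le_one
      _ = _ := by ring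
  obtain ⟨hdiff, hrsc⟩ := squareLoss_restricted_strong_convexity (F := empLoss φ x y)
    (f := fun i θ => predictor φ θ (x i)) (fun _ => rfl) hf hg hR0 hB hκ (by positivity)
  refine ⟨hdiff, fun θ' hθ' E hE => ?_⟩
  have hmain := hrsc θ' hθ'.1
  have ht : ‖θ' - θ‖ ≤ ρ₂ := mem_closedBall_iff_norm.1 hθ'.2
  have hE' : 4 * (R * ((b + (1 + ρ₁) * (K * √(L : ℝ))) * ‖θ' - θ‖ +
      ((1 + Y ^ 2) / 2 + (1 + ρ₁) * b))) ≤ E := by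
    refine le_trans ?_ hE
    have hslope := slope_add_residual_le (Y := Y) (q := √(L : ℝ) * r / W) hρ₁.le
      (norm_nonneg (θ' - θ)) ht hb1 (by positivity)
    have e : K * √(L : ℝ) = 2 * b * (√(L : ℝ) * r / W) := by rw [hK]; ring
    rw [← e] at hslope
    have hN : 0 < min W (W ^ 2) := lt_min hW (by positivity)
    calc _ ≤ 4 * (((9 + 8 * β) * ((1 + ρ₁) * (L : ℝ) ^ 3 * G / min W (W ^ 2))) *
          ((3 + Y ^ 2) * ((1 + ρ₂) * (1 + ρ₁) * b * (1 + √(L : ℝ) * r / W)))) := by gcongr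
      _ = _ := by rw [sharpCorrection]; ring
  refine le_trans ?_ hmain
  rw [rscParam]
  gcongr

end Bound

end WeightNorm

/-! ### The main theorem -/

theorem mainTheorem5 :
    ∀ β Y : ℝ, ∃ C : ℝ, 0 < C ∧
      ∀ (L m n : ℕ) (w : ℕ → ℕ), 1 ≤ L → (∀ l, 1 ≤ l → l ≤ L → w l = m) →
      ∀ φ : ℝ → ℝ, Differentiable ℝ φ → Differentiable ℝ (deriv φ) →
        (∀ t, |deriv φ t| ≤ 1) → (∀ t, |deriv (deriv φ) t| ≤ β) →
      ∀ (x : Fin n → EuclideanSpace ℝ (Fin (w 0))) (y : Fin n → ℝ),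
        (∀ i, ‖x i‖ = 1) → (1 / (n : ℝ)) * ∑ i, y i ^ 2 ≤ Y ^ 2 →
      ∀ v₀ : EuclideanSpace ℝ (Fin (w L)), ‖v₀‖ = 1 →
      ∀ κ ρ₁ ρ₂ : ℝ, 0 < κ → κ ≤ 1 → 0 < ρ₁ → 0 < ρ₂ →
      ∀ θ : WeightNorm.Param w L, (∀ l i, WeightNorm.row θ l i ≠ 0) →
        WeightNorm.outVec θ ∈ Metric.closedBall v₀ ρ₁ →
        DifferentiableAt ℝ (WeightNorm.empLoss φ x y) θ ∧
        ∀ θ' ∈ WeightNorm.qSet (WeightNorm.empLoss φ x y) κ θ ∩ Metric.closedBall θ ρ₂,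
          WeightNorm.outVec θ' ∈ Metric.closedBall v₀ ρ₁ →
          (WeightNorm.empLoss φ x y θ' ≥ WeightNorm.empLoss φ x y θ +
              inner ℝ (θ' - θ) (gradient (WeightNorm.empLoss φ x y) θ) +
              WeightNorm.rscParam (WeightNorm.empLoss φ x y) κ
                  (C * WeightNorm.correction m L ρ₁ ρ₂ |φ 0| (WeightNorm.minRowNorm θ)) θ / 2 *
                ‖θ' - θ‖ ^ 2) ∧
          (φ 0 = 0 →
            WeightNorm.empLoss φ x y θ' ≥ WeightNorm.empLoss φ x y θ +
              inner ℝ (θ' - θ) (gradient (WeightNorm.empLoss φ x y) θ) +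
              WeightNorm.rscParam (WeightNorm.empLoss φ x y) κ
                  (C * WeightNorm.correctionZero m L ρ₁ ρ₂ (WeightNorm.minRowNorm θ)) θ / 2 *
                ‖θ' - θ‖ ^ 2) := by

  intro β Y
  -- The factors come from the abstract square loss bound, `remainder_le` and
  -- `slope_add_residual_le`; `|β|` keeps the constant positive for every real `β`.
  refine ⟨4 * (9 + 8 * |β|) * (3 + Y ^ 2), by positivity, ?_⟩
  intro L m n w hL hm φ hφ hφ' h1 h2 x y hx hy v₀ hv₀ κ ρ₁ ρ₂ hκ _ hρ₁ hρ₂ θ hθ hv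
  -- A unit vector `v₀` cannot exist in dimension `0`.
  have hm1 : 1 ≤ m := by
    rcases Nat.eq_zero_or_pos m with h0 | h0
    · have hwL : w L = 0 := (hm L hL le_rfl).trans h0
      have : IsEmpty (Fin (w L)) := by rw [hwL]; infer_instance
      rw [Subsingleton.elim v₀ 0, norm_zero] at hv₀
      exact absurd hv₀ zero_ne_one
    · exact h0
  have hV : ‖WeightNorm.outVec θ‖ ≤ 1 + ρ₁ := by
    rw [← hv₀]
    exact norm_le_norm_add_const_of_dist_le (Metric.mem_closedBall.1 hv)
  obtain ⟨hW, hdiff, hrsc⟩ := WeightNorm.empLoss_restricted_strong_convexity hL hm hm1 hφ hφ' h1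
    (fun t => (h2 t).trans (le_abs_self β)) hx hy hκ hρ₁ (ρ₂ := ρ₂) hθ hV
  refine ⟨hdiff, fun θ' hθ' _ => ⟨hrsc θ' hθ' _ ?_, fun h0 => hrsc θ' hθ' _ ?_⟩⟩
  · gcongr
    exact WeightNorm.sharpCorrection_le_correction hm1 hρ₁.le hρ₂.le (abs_nonneg _) hW
  · rw [h0, abs_zero]
    gcongr
    exact WeightNorm.sharpCorrection_zero_le hm1 hρ₁.le hρ₂.le hW
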